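/- Let $M$ be a matroid on a finite ground set, $L(M)$ its lattice of flats with minimum element $0$ (equal to $\emptyset$ if $M$ has no loops) and Möbius function $\mu$, and let $\chi_M(t)=\sum_{F\in L(M)}\mu(0,F)\,t^{\operatorname{rk}M-\operatorname{rk}F}$ be its characteristic polynomial. For a flat $F$, let $M_F$ be the matroid on $F$ whose independent sets are the subsets of $F$ independent in $M$, and let $M^F$ be the contraction of $M$ at $F$. The Kazhdan–Lusztig polynomials $P_M(t)\in\mathbb Z[t]$ are the unique polynomials such that $P_M(t)=1$ if $\operatorname{rk}M=0$; $\deg P_M(t)<\tfrac12\operatorname{rk}M$ if $\operatorname{rk}M>0$; and $t^{\operatorname{rk}M}P_M(t^{-1})=\sum_{F\in L(M)}\chi_{M_F}(t)\,P_{M^F}(t)$ for every $M$. Let $U_{1,d}$ be the uniform matroid of rank $d$ on $d+1$ elements. **Theorem.** For every integer $d>0$, every complex root of $P_{U_{1,d}}(t)$ is real and strictly negative. -/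

import Mathlib

namespace KLMatroid

open Polynomial

universe u

variable {α : Type u}

open scoped Matroid

/-- The rank `rk M` of a finite matroid, as a natural number. -/
noncomputable def rank (M : Matroid α) : ℕ := M.eRank.toNat

/-- The set `L(M)` of flats of `M`, ordered by inclusion. -/
abbrev Flat (M : Matroid α) : Type u := {F : Set α // M.IsFlat F}

/-- The minimum element of `L(M)`: the closure of `∅`. It is `∅` when `M` has no loops. -/
def minFlat (M : Matroid α) : Flat M := ⟨M.closure ∅, M.isFlat_closure ∅⟩

instance finite_flat (M : Matroid α) [M.Finite] : Finite (Flat M) :=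
  (M.ground_finite.finite_subsets.subset fun _ hF => hF.subset_ground).to_subtype

noncomputable instance fintypeFlat (M : Matroid α) [M.Finite] : Fintype (Flat M) :=
  Fintype.ofFinite _

open Classical in
noncomputable instance locallyFiniteOrderFlat (M : Matroid α) [M.Finite] :
    LocallyFiniteOrder (Flat M) :=
  Fintype.toLocallyFiniteOrder

open Classical in
/-- The characteristic polynomial
`χ_M(t) = ∑_{F ∈ L(M)} μ(0, F) t ^ (rk M - rk F)`, where `μ` is the Möbius function of `L(M)`
and `0` is the minimum of `L(M)`. -/
noncomputable def charPoly (M : Matroid α) [M.Finite] : ℤ[X] :=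
  ∑ F : Flat M, C (IncidenceAlgebra.mu ℤ (minFlat M) F) * X ^ (rank M - (M.eRk F.1).toNat)

/-- The localization `M_F` of `M` at a flat `F`: the matroid on `F` whose independent sets are the
subsets of `F` independent in `M`. -/
abbrev localization (M : Matroid α) (F : Flat M) : Matroid α := M ↾ F.1

/-- The contraction `M^F` of `M` at a flat `F` (a matroid on `M.E \ F`); its independent sets are
the sets whose union with a basis of `F` is independent in `M`. -/
abbrev contraction (M : Matroid α) (F : Flat M) : Matroid α := M ／ F.1

instance localization_finite (M : Matroid α) [M.Finite] (F : Flat M) :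
    (localization M F).Finite :=
  Matroid.restrict_finite (M.ground_finite.subset F.2.subset_ground)

theorem ncard_contraction_lt (M : Matroid α) [M.Finite] (F : Flat M) (hF : F ≠ minFlat M) :
    (contraction M F).E.ncard < M.E.ncard := by
  have hne : F.1.Nonempty := by
    by_contra h
    rw [Set.not_nonempty_iff_eq_empty] at h
    apply hF
    apply Subtype.ext
    have := F.2.closure
    rw [h] at this
    rw [h]
    exact this.symm
  obtain ⟨x, hx⟩ := hne
  refine Set.ncard_lt_ncard ?_ M.ground_finite
  refine ⟨Set.sdiff_subset, fun h => ?_⟩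
  exact (h (F.2.subset_ground hx)).2 hx

open Classical in
/-- The Kazhdan–Lusztig polynomial `P_M(t)`. If `rk M = 0` it is `1`. If `r = rk M > 0`, then the
recursion `t ^ r * P_M(t⁻¹) = ∑_F χ_{M_F}(t) * P_{M^F}(t)` and the condition `2 * deg P_M < r` say
that the coefficient of `t ^ i` in `P_M`, for `2 * i < r`, is the coefficient of `t ^ (r - i)` in
the sum of `χ_{M_F} * P_{M^F}` over the flats `F` other than the minimum one (whose own term has
degree less than `r / 2`). See `IsKLAssignment.eq_klPoly`. -/
noncomputable def klPoly (M : Matroid α) [M.Finite] : ℤ[X] :=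
  if rank M = 0 then 1
  else ∑ i ∈ Finset.range (rank M) with 2 * i < rank M,
    C ((∑ F : {F : Flat M // F ≠ minFlat M},
      charPoly (localization M F.1) * klPoly (contraction M F.1)).coeff (rank M - i)) * X ^ i
termination_by M.E.ncard
decreasing_by exact ncard_contraction_lt M F.1 F.2

/-- The three conditions that characterize the Kazhdan–Lusztig polynomials of matroids;
`reflect (rank M) (P M)` is `t ^ rk M * P_M(t⁻¹)`. -/
structure IsKLAssignment (P : (M : Matroid α) → [M.Finite] → ℤ[X]) : Prop where
  rank_zero : ∀ (M : Matroid α) [M.Finite], rank M = 0 → P M = 1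
  degree_lt : ∀ (M : Matroid α) [M.Finite], 0 < rank M → 2 * (P M).natDegree < rank M
  recursion : ∀ (M : Matroid α) [M.Finite],
    reflect (rank M) (P M) = ∑ F : Flat M, charPoly (localization M F) * P (contraction M F)

theorem charPoly_eq_one_of_rank_zero (M : Matroid α) [M.Finite] (h : rank M = 0) :
    charPoly M = 1 := by
  have hr : M.eRank = 0 := by
    rcases (ENat.toNat_eq_zero).1 h with h | h
    · exact h
    · exact absurd h (M.eRank_ne_top_iff.2 inferInstance)
  have hall : ∀ F : Flat M, F = minFlat M := by
    intro F
    apply Subtype.ext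
    have h0 : M.eRk F.1 = 0 := le_antisymm (hr ▸ M.eRk_le_eRank F.1) bot_le
    have h1 := (Matroid.eRk_eq_zero_iff F.2.subset_ground).1 h0
    exact h1.antisymm F.2.loops_subset
  rw [charPoly, Fintype.sum_eq_single (minFlat M) (fun F hF => absurd (hall F) hF)]
  simp [h]

theorem rank_contraction_minFlat (M : Matroid α) [M.Finite] :
    rank (contraction M (minFlat M)) = rank M := by
  have : contraction M (minFlat M) = M ＼ M.loops :=
    Matroid.contract_eq_delete_of_subset_loops subset_rfl
  unfold rank
  rw [this, Matroid.delete_eq_restrict, Matroid.eRank_restrict]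
  have h := M.eRk_eq_eRk_sdiff_eRk_le_zero M.E (Y := M.loops) (by simp)
  rw [h, Matroid.eRk_ground]

open Classical in
/-- `klPoly` is the only possible assignment satisfying the three conditions. -/
theorem IsKLAssignment.eq_klPoly {P : (M : Matroid α) → [M.Finite] → ℤ[X]}
    (hP : IsKLAssignment P) (M : Matroid α) [M.Finite] : P M = klPoly M := by
  induction hn : M.E.ncard using Nat.strong_induction_on generalizing M with
  | _ n ih =>
  rw [klPoly]
  split_ifs with h0
  · exact hP.rank_zero M h0
  have hdeg := hP.degree_lt M (Nat.pos_of_ne_zero h0)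
  have hrec := hP.recursion M
  have hS : (∑ F : Flat M, charPoly (localization M F) * P (contraction M F)) =
      P (contraction M (minFlat M)) + ∑ F : {F : Flat M // F ≠ minFlat M},
        charPoly (localization M F.1) * klPoly (contraction M F.1) := by
    rw [← Finset.add_sum_erase _ _ (Finset.mem_univ (minFlat M))]
    congr 1
    · rw [charPoly_eq_one_of_rank_zero, one_mul]
      simp [rank, minFlat, Matroid.eRank_restrict]
    · rw [Finset.sum_subtype (p := fun F => F ≠ minFlat M) _ (by simp)]
      refine Finset.sum_congr rfl fun F _ => ?_
      rw [ih _ (hn ▸ ncard_contraction_lt M F.1 F.2) _ rfl]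
  rw [hS] at hrec
  ext j
  simp only [finsetSum_coeff, coeff_C_mul_X_pow]
  by_cases hj : 2 * j < rank M
  · rw [Finset.sum_eq_single j (fun b _ hb => if_neg (Ne.symm hb))
      (fun h => absurd (by simp; omega) h)]
    have hc := congrArg (fun p => p.coeff (rank M - j)) hrec
    have hmin := hP.degree_lt (contraction M (minFlat M))
      (by rw [rank_contraction_minFlat]; omega)
    rw [rank_contraction_minFlat] at hmin
    simp only [coeff_reflect, coeff_add] at hc
    rw [revAt_le (Nat.sub_le _ _), Nat.sub_sub_self (by omega),
      coeff_eq_zero_of_natDegree_lt (p := P (contraction M (minFlat M))) (by omega),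
      zero_add] at hc
    simpa using hc
  · rw [coeff_eq_zero_of_natDegree_lt (by omega), Finset.sum_eq_zero]
    intro i hi
    rw [if_neg]
    rintro rfl
    simp at hi
    omega

/-- The matroid on `E` whose independent sets are the subsets of `E` with at most `d` elements. -/
def uniformOn (E : Set α) (d : ℕ) : Matroid α :=
  (IndepMatroid.ofBddAugment E (fun I => I ⊆ E ∧ I.encard ≤ d)
    ⟨Set.empty_subset _, by simp⟩
    (fun _ _ hJ hIJ => ⟨hIJ.trans hJ.1, (Set.encard_le_encard hIJ).trans hJ.2⟩)
    (by
      intro I J hI hJ hlt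
      obtain ⟨e, heJ, heI⟩ : ∃ e ∈ J, e ∉ I := by
        by_contra! h
        exact absurd (Set.encard_le_encard h) (not_le.2 hlt)
      refine ⟨e, heJ, heI, Set.insert_subset (hJ.1 heJ) hI.1, ?_⟩
      exact (Set.encard_insert_le I e).trans ((Order.add_one_le_of_lt hlt).trans hJ.2))
    ⟨d, fun _ hI => hI.2⟩
    (fun _ hI => hI.1)).matroid

theorem uniformOn_indep_iff {E I : Set α} {d : ℕ} :
    (uniformOn E d).Indep I ↔ I ⊆ E ∧ I.encard ≤ d := by
  simp [uniformOn]

/-- The uniform matroid `U_{m,d}` of rank `d` on `m + d` elements. -/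
def uniform (m d : ℕ) : Matroid (Fin (m + d)) := uniformOn Set.univ d

end KLMatroid

/-!
The proof has two parts.

*The closed form.* For `d > 0` the coefficient of `t ^ i` in the Kazhdan–Lusztig polynomial of
`U_{1,d}` is `C(d - 1 - i, i) * C(d + 1, i) / (i + 1)` (`map_klPoly_uniformOn`). The flats of
`U_{1,d}` are the sets with fewer than `d` elements and the ground set. The localization at a flat
with `k < d` elements is free, with characteristic polynomial `(t - 1) ^ k`, and the contraction is
`U_{1,d-k}`; at the ground set, the contraction has rank `0` and the relevant coefficients of the
characteristic polynomial only involve Boolean intervals. So the recursion expresses the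
coefficients of `P_d` by those of `P_{d-k}`, and the closed form satisfies it by an identity of
binomial sums (`sum_coeff_closedForm`): for each exponent `i` in `P_{d-k}`, the sum over `k` is a
truncated finite difference of a polynomial of degree `i`.

*The roots.* With `L` the Lucas polynomials, the closed form gives
`(d + 1) * z * P_d(z) = [x ^ (d + 2)] L_{d+1}(z x) * (1 + x) ^ (d + 1)` (`coeff_lucasPoly_mul_pow`).
If `u + v = 1`, then `L_n(-u v) = u ^ n + v ^ n`, whence the roots of `L_n` are real and negative.
Therefore, if `z` is not in `(-∞, 0]`, the roots `-a / z` and `-1` of the polynomial in `x` on the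
right all lie in an open half plane bounded by a line through `0`. By the Gauss–Lucas theorem the
same is true of all its derivatives, so none of its coefficients up to its degree vanishes
(`coeff_ne_zero_of_roots_mem_halfPlane`), and `P_d(z) ≠ 0`. This is the case needed here of the
theorem that the Hadamard product of polynomials with nonpositive real roots is real-rooted.
-/

namespace KLMatroid

open Polynomial

/-! ### The closed form -/

/-- The coefficient of `t ^ i` in the Kazhdan–Lusztig polynomial of the uniform matroid of rank
`d` on `d + 1` elements (for `d > 0`). The truncated subtractions are harmless: the first binomial
coefficient vanishes whenever `d ≤ 2 * i`. -/
def klCoeff (d i : ℕ) : ℚ := (d - 1 - i).choose i * (d + 1).choose i / (i + 1)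

/-- The polynomial with coefficients `klCoeff d i`. -/
noncomputable def closedForm (d : ℕ) : ℚ[X] := ∑ i ∈ Finset.range d, C (klCoeff d i) * X ^ i

theorem klCoeff_eq_zero {d i : ℕ} (hd : 0 < d) (h : d ≤ 2 * i) : klCoeff d i = 0 := by
  rw [klCoeff, Nat.choose_eq_zero_of_lt (by omega)]
  simp

theorem coeff_closedForm {d : ℕ} (hd : 0 < d) (i : ℕ) : (closedForm d).coeff i = klCoeff d i := by
  simp only [closedForm, finsetSum_coeff, coeff_C_mul_X_pow]
  rw [Finset.sum_ite_eq]
  split_ifs with h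
  · rfl
  · rw [klCoeff_eq_zero hd]
    simp at h
    omega

/-! ### Coefficients of polynomials whose roots lie in an open half plane -/

/-- A consequence of the Gauss–Lucas theorem: the half plane contains the roots of all derivatives
of `p` too, so none of these vanishes at `0`. -/
theorem coeff_ne_zero_of_roots_mem_halfPlane {w : ℂ} {p : ℂ[X]} (hp : p ≠ 0)
    (h : ∀ r, p.IsRoot r → 0 < (w * r).re) {k : ℕ} (hk : k ≤ p.natDegree) : p.coeff k ≠ 0 := by
  induction k generalizing p with
  | zero =>
    intro h0
    have := h 0 (by rwa [IsRoot, ← coeff_zero_eq_eval_zero])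
    simp at this
  | succ k ih =>
    have hdeg : (derivative p).natDegree = p.natDegree - 1 := natDegree_derivative p
    have hpos : 0 < p.degree := natDegree_pos_iff_degree_pos.1 (by omega)
    have hp' : derivative p ≠ 0 := by
      rw [Ne, derivative_eq_zero]
      omega
    have hroots : ∀ r, (derivative p).IsRoot r → 0 < (w * r).re := by
      intro r hr
      have hmem := rootSet_derivative_subset_convexHull_rootSet hpos
        ((mem_rootSet_of_ne hp').2 (by simpa using hr))
      have hconv : Convex ℝ {r : ℂ | 0 < (w * r).re} :=
        convex_halfSpace_gt
          ⟨fun x y => by rw [mul_add, Complex.add_re], fun c x => by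
            rw [mul_smul_comm, Complex.smul_re]⟩ 0
      exact convexHull_min (fun x hx => h x (by simpa using (mem_rootSet.1 hx).2)) hconv hmem
    have := ih hp' hroots (by omega)
    rw [coeff_derivative] at this
    exact left_ne_zero_of_mul this

/-! ### Lucas polynomials -/

/-- The Lucas polynomials: `L₀ = 2`, `L₁ = 1` and `Lₙ₊₂ = Lₙ₊₁ + t * Lₙ`. -/
noncomputable def lucasPoly : ℕ → ℂ[X]
  | 0 => 2
  | 1 => 1
  | n + 2 => lucasPoly (n + 1) + X * lucasPoly n

theorem eval_lucasPoly (u : ℂ) (n : ℕ) :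
    (lucasPoly n).eval (-(u * (1 - u))) = u ^ n + (1 - u) ^ n := by
  induction n using Nat.strong_induction_on with
  | _ n ih =>
  match n with
  | 0 => simp [lucasPoly]; norm_num
  | 1 => simp [lucasPoly]
  | n + 2 =>
    rw [lucasPoly, eval_add, eval_mul, eval_X, ih (n + 1) (by omega), ih n (by omega)]
    ring

/-- If `u + v = 1` and `u ^ n = -v ^ n`, then `‖u‖ = ‖v‖`, so `v` is the complex conjugate of `u`
and the root `-u * v` is `-‖u‖ ^ 2`. -/
theorem exists_of_isRoot_lucasPoly {n : ℕ} (hn : n ≠ 0) {r : ℂ} (h : (lucasPoly n).IsRoot r) :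
    ∃ a : ℝ, 0 < a ∧ r = -(a : ℂ) := by
  obtain ⟨s, hs⟩ := IsAlgClosed.exists_pow_nat_eq (1 + 4 * r) (n := 2) (by norm_num)
  obtain ⟨u, hu⟩ : ∃ u : ℂ, u = (1 + s) / 2 := ⟨_, rfl⟩
  have hr : r = -(u * (1 - u)) := by
    rw [hu]; linear_combination -hs / 4
  rw [IsRoot, hr, eval_lucasPoly] at h
  have hnorm : ‖u‖ = ‖1 - u‖ := by
    have : u ^ n = -(1 - u) ^ n := eq_neg_of_add_eq_zero_left h
    have := congrArg norm this
    rw [norm_neg, norm_pow, norm_pow] at this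
    exact (pow_left_inj₀ (norm_nonneg _) (norm_nonneg _) hn).1 this
  have hre : u.re = 1 / 2 := by
    have h2 : Complex.normSq u = Complex.normSq (1 - u) := by
      rw [Complex.normSq_eq_norm_sq, Complex.normSq_eq_norm_sq, hnorm]
    simp only [Complex.normSq_apply, Complex.sub_re, Complex.one_re, Complex.sub_im,
      Complex.one_im] at h2
    linarith
  refine ⟨u.re * u.re + u.im * u.im, by nlinarith [mul_self_nonneg u.im], ?_⟩
  rw [hr]
  apply Complex.ext <;> simp [hre] <;> ring

theorem coeff_zero_lucasPoly (n : ℕ) : (lucasPoly (n + 1)).coeff 0 = 1 := by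
  induction n using Nat.strong_induction_on with
  | _ n ih =>
  match n with
  | 0 => simp [lucasPoly]
  | n + 1 => rw [lucasPoly, coeff_add, coeff_X_mul_zero, ih n (by omega), add_zero]

/-- The usual formula for the coefficients of Lucas polynomials. For `n < j` the truncated
subtraction gives `choose 0 j = 0`, as it should. -/
theorem succ_mul_coeff_succ_lucasPoly (n j : ℕ) :
    ((j : ℂ) + 1) * (lucasPoly (n + 2)).coeff (j + 1) = (n + 2) * (n - j).choose j := by
  induction n using Nat.strong_induction_on generalizing j with
  | _ n ih =>
  match n, j with
  | 0, 0 => simp [lucasPoly, coeff_one]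
  | 0, j + 1 => simp [lucasPoly, coeff_one, ← C_ofNat]
  | 1, 0 => simp [lucasPoly, coeff_one, coeff_X]; norm_num
  | 1, j + 1 =>
    simp [lucasPoly, coeff_one, coeff_X, ← C_ofNat]
  | n + 2, 0 =>
    rw [lucasPoly, coeff_add, coeff_X_mul, coeff_zero_lucasPoly]
    have := ih (n + 1) (by omega) 0
    simp at this ⊢
    rw [this]
    ring
  | n + 2, j + 1 =>
    have h1 := ih (n + 1) (by omega) (j + 1)
    have h2 := ih n (by omega) j
    rw [lucasPoly, coeff_add, coeff_X_mul]
    by_cases hj : j ≤ n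
    · obtain ⟨a, rfl⟩ := Nat.exists_eq_add_of_le hj
      have e1 : j + a + 1 - (j + 1) = a := by omega
      have e2 : j + a - j = a := by omega
      have e3 : j + a + 2 - (j + 1) = a + 1 := by omega
      rw [e1] at h1
      rw [e2] at h2
      rw [e3, Nat.choose_succ_succ]
      have h3 : ((a.choose (j + 1) : ℕ) : ℂ) * (j + 1) = a.choose j * (a - j) := by
        by_cases haj : j ≤ a
        · have := Nat.choose_succ_right_eq a j
          rw [← Nat.cast_sub haj]
          exact_mod_cast this
        · rw [Nat.choose_eq_zero_of_lt (by omega), Nat.choose_eq_zero_of_lt (by omega)]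
          simp
      have hj1 : (j : ℂ) + 1 ≠ 0 := by exact_mod_cast j.succ_ne_zero
      apply mul_left_cancel₀ hj1
      push_cast at h1 h2 ⊢
      linear_combination (j + 1 : ℂ) * h1 + (j + 2 : ℂ) * h2 - h3
    · rw [Nat.choose_eq_zero_of_lt (by omega)] at h1 h2 ⊢
      have hj1 : (j : ℂ) + 1 ≠ 0 := by exact_mod_cast j.succ_ne_zero
      have hj2 : (j : ℂ) + 1 + 1 ≠ 0 := by exact_mod_cast (j + 1).succ_ne_zero
      have e1 : (lucasPoly (n + 1 + 2)).coeff (j + 1 + 1) = 0 := by simpa [hj2] using h1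
      have e2 : (lucasPoly (n + 2)).coeff (j + 1) = 0 := by simpa [hj1] using h2
      simp [e1, e2]

/-! ### Real-rootedness -/

/-- The closed form is, up to the factor `(d + 1) * z`, the Hadamard product of a Lucas polynomial
and of `t * (1 + t) ^ (d + 1)`, evaluated at `z`. -/
theorem coeff_lucasPoly_mul_pow {d : ℕ} (hd : 0 < d) (z : ℂ) :
    ((lucasPoly (d + 1)).comp (C z * X) * (1 + X) ^ (d + 1)).coeff (d + 2) =
      (d + 1) * z * aeval z (closedForm d) := by
  obtain ⟨n, rfl⟩ := Nat.exists_eq_add_of_le' hd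
  rw [coeff_mul, Finset.Nat.antidiagonal_succ, Finset.sum_cons, Finset.sum_map,
    coeff_one_add_X_pow, Nat.choose_eq_zero_of_lt (by simp),
    Finset.Nat.sum_antidiagonal_eq_sum_range_succ_mk]
  simp only [Nat.cast_zero, mul_zero, zero_add, Function.Embedding.prodMap, closedForm, map_sum,
    map_mul, aeval_C, map_pow, aeval_X, Finset.mul_sum]
  symm
  apply Finset.sum_subset_zero_on_sdiff
  · intro i hi; simp at hi ⊢; omega
  · intro i hi
    simp only [Finset.mem_sdiff, Finset.mem_range, not_lt] at hi
    have h := succ_mul_coeff_succ_lucasPoly n i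
    rw [Nat.choose_eq_zero_of_lt (by omega)] at h
    have hi1 : (i : ℂ) + 1 ≠ 0 := by exact_mod_cast i.succ_ne_zero
    have h' : (lucasPoly (n + 2)).coeff (i + 1) = 0 := by simpa [hi1] using h
    simp [comp_C_mul_X_coeff, h']
  · intro i hi
    simp only [Finset.mem_range] at hi
    have h := succ_mul_coeff_succ_lucasPoly n i
    have hi1 : (i : ℂ) + 1 ≠ 0 := by exact_mod_cast i.succ_ne_zero
    have hc : (n + 1 + 1).choose (n + 1 + 1 - i) = (n + 1 + 1).choose i :=
      Nat.choose_symm (by omega)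
    simp only [Prod.map, Function.Embedding.coeFn_mk, Nat.succ_eq_add_one,
      Function.Embedding.refl_apply, comp_C_mul_X_coeff, coeff_one_add_X_pow, hc, klCoeff,
      eq_ratCast]
    rw [Nat.add_sub_cancel]
    push_cast
    field_simp
    linear_combination -(z ^ (i + 1) * ((n + 1 + 1).choose i : ℂ)) * h

/-- If `z` is neither `0` nor a negative real number, then the roots of
`L(z x) * (1 + x) ^ (d + 1)` lie in an open half plane, so its coefficient `(d + 1) * z * P_d(z)` does not vanish. -/
theorem aeval_closedForm_eq_zero {d : ℕ} (hd : 0 < d) {z : ℂ} (hz : aeval z (closedForm d) = 0) :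
    ∃ x : ℝ, x < 0 ∧ z = (x : ℂ) := by
  have hz0 : z ≠ 0 := by
    rintro rfl
    rw [← coeff_zero_eq_aeval_zero', coeff_closedForm hd] at hz
    simp [klCoeff] at hz
  by_contra hneg
  -- As `z + ‖z‖` bisects the angle between `1` and `z`, both `-1` and the negative multiples of
  -- `z⁻¹` lie in the half plane `0 < re (-(z + ‖z‖) * r)`.
  have hre : 0 < z.re + ‖z‖ := by
    by_contra hle
    have h1 : z.re = -‖z‖ := by
      have := neg_abs_le z.re
      have := Complex.abs_re_le_norm z
      linarith
    have h2 : z.im = 0 := by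
      have := Complex.sq_norm z
      rw [Complex.normSq_apply, h1] at this
      have : z.im * z.im = 0 := by linarith
      simpa using this
    refine hneg ⟨-‖z‖, by simpa using hz0, ?_⟩
    apply Complex.ext <;> simp [h1, h2]
  have hn : 0 < ‖z‖ := norm_pos_iff.2 hz0
  obtain ⟨n, rfl⟩ := Nat.exists_eq_add_of_le' hd
  have hcoeff : (lucasPoly (n + 1 + 1)).coeff 1 ≠ 0 := by
    have := succ_mul_coeff_succ_lucasPoly n 0
    simp at this
    rw [this]
    exact_mod_cast (n + 1).succ_ne_zero
  have hL0 : lucasPoly (n + 1 + 1) ≠ 0 := by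
    intro h; rw [h] at hcoeff; simp at hcoeff
  have hdegX : (C z * X).natDegree = 1 := natDegree_C_mul_X z hz0
  have hcomp0 : (lucasPoly (n + 1 + 1)).comp (C z * X) ≠ 0 := by
    intro h
    have := congrArg (coeff · 1) h
    simp [comp_C_mul_X_coeff, hz0, hcoeff] at this
  have hdegpow : ((1 + X : ℂ[X]) ^ (n + 1 + 1)).natDegree = n + 1 + 1 := by
    rw [add_comm 1 X, ← C_1, natDegree_pow, natDegree_X_add_C, mul_one]
  have hpow0 : (1 + X : ℂ[X]) ^ (n + 1 + 1) ≠ 0 := by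
    intro h; rw [h] at hdegpow; simp at hdegpow
  refine coeff_ne_zero_of_roots_mem_halfPlane (w := -(z + ‖z‖)) (k := n + 1 + 2)
    (mul_ne_zero hcomp0 hpow0) ?_ ?_
    (by rw [coeff_lucasPoly_mul_pow hd, hz, mul_zero])
  · intro r hr
    rw [IsRoot, eval_mul, mul_eq_zero] at hr
    rcases hr with hr | hr
    · rw [eval_comp] at hr
      obtain ⟨a, ha, hra⟩ := exists_of_isRoot_lucasPoly (by omega) hr
      simp only [eval_mul, eval_C, eval_X] at hra
      have hr' : r = -(a : ℂ) * z⁻¹ := by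
        rw [← hra]; field_simp
      have : -(z + ‖z‖) * r = a + (a * ‖z‖ : ℝ) * z⁻¹ := by
        rw [hr']; push_cast; field_simp
      rw [this, Complex.add_re, Complex.ofReal_re, Complex.re_ofReal_mul, Complex.inv_re,
        Complex.normSq_eq_norm_sq]
      have : a + a * ‖z‖ * (z.re / ‖z‖ ^ 2) = a * (z.re + ‖z‖) / ‖z‖ := by field_simp; ring
      rw [this]
      positivity
    · have : r = -1 := by
        have := eq_zero_of_pow_eq_zero (by simpa using hr : (1 + r) ^ (n + 1 + 1) = 0)
        linear_combination this
      rw [this]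
      simpa using hre
  · rw [natDegree_mul hcomp0 hpow0, hdegpow, natDegree_comp, hdegX, mul_one]
    have := le_natDegree_of_ne_zero hcoeff
    omega

/-! ### Alternating sums of binomial coefficients -/

/-- The coefficient of `X ^ i` in `((1 + X) - 1) ^ n = X ^ n`. The next two sums follow from this
one by summing over `n`. -/
theorem sum_choose_mul_choose (n i N : ℕ) (hN : n < N) :
    ∑ m ∈ Finset.range N, (-1 : ℚ) ^ m * n.choose m * m.choose i =
      if n = i then (-1) ^ i else 0 := by
  have h : ((1 + X : ℚ[X]) + (-1)) ^ n = X ^ n := by ring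
  rw [add_pow] at h
  have hc := congrArg (coeff · i) h
  simp only [finsetSum_coeff, coeff_X_pow] at hc
  rw [← Finset.sum_subset (Finset.range_subset_range.2 hN)]
  · calc _ = (-1 : ℚ) ^ n * ∑ m ∈ Finset.range (n + 1),
            ((1 + X : ℚ[X]) ^ m * (-1) ^ (n - m) * (n.choose m : ℚ[X])).coeff i := by
          rw [Finset.mul_sum]
          refine Finset.sum_congr rfl fun m hm => ?_
          have e : ((1 + X : ℚ[X]) ^ m * (-1) ^ (n - m) * (n.choose m : ℚ[X])) =
              C ((-1) ^ (n - m) * (n.choose m : ℚ)) * (1 + X) ^ m := by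
            simp; ring
          rw [e, coeff_C_mul, coeff_one_add_X_pow]
          obtain ⟨b, rfl⟩ := Nat.exists_eq_add_of_le (Nat.lt_succ_iff.1 (Finset.mem_range.1 hm))
          rw [Nat.add_sub_cancel_left, pow_add]
          have : (-1 : ℚ) ^ b * (-1) ^ b = 1 := by rw [← mul_pow]; simp
          linear_combination (-(-1 : ℚ) ^ m * (m + b).choose m * m.choose i) * this
      _ = _ := by
          rw [hc]
          by_cases hni : n = i
          · simp [hni]
          · simp [hni, Ne.symm hni]
  · intro m _ hm
    rw [Nat.choose_eq_zero_of_lt (by simpa using hm)]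
    simp

theorem sum_choose_succ_mul_choose (n i N : ℕ) (hN : n < N) :
    ∑ m ∈ Finset.range N, (-1 : ℚ) ^ m * (n + 1).choose (m + 1) * m.choose i =
      if i ≤ n then (-1) ^ i else 0 := by
  induction n with
  | zero =>
    rw [Finset.sum_eq_single_of_mem 0 (by simpa using hN)]
    · cases i <;> simp
    · intro b _ hb
      rw [Nat.choose_eq_zero_of_lt (by omega)]
      simp
  | succ n ih =>
    have h := sum_choose_mul_choose (n + 1) i N hN
    calc _ = (∑ m ∈ Finset.range N, (-1 : ℚ) ^ m * (n + 1).choose m * m.choose i) +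
          ∑ m ∈ Finset.range N, (-1 : ℚ) ^ m * (n + 1).choose (m + 1) * m.choose i := by
          rw [← Finset.sum_add_distrib]
          refine Finset.sum_congr rfl fun m _ => ?_
          rw [Nat.choose_succ_succ' (n + 1) m]
          push_cast
          ring
      _ = _ := by
          rw [h, ih (by omega)]
          rcases lt_trichotomy i (n + 1) with hi | hi | hi
          · rw [if_neg (by omega), if_pos (by omega), if_pos (by omega), zero_add]
          · rw [if_pos (by omega), if_neg (by omega), if_pos (by omega), add_zero]
          · rw [if_neg (by omega), if_neg (by omega), if_neg (by omega), add_zero]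

theorem sum_choose_add_two_mul_choose (n i N : ℕ) (hN : n ≤ N) :
    ∑ m ∈ Finset.range N, (-1 : ℚ) ^ m * (n + 1).choose (m + 2) * m.choose i =
      (-1) ^ i * (n - i : ℕ) := by
  induction n with
  | zero =>
    rw [Finset.sum_eq_zero]
    · simp
    · intro m _
      rw [Nat.choose_eq_zero_of_lt (by omega)]
      simp
  | succ n ih =>
    calc _ = (∑ m ∈ Finset.range N, (-1 : ℚ) ^ m * (n + 1).choose (m + 1) * m.choose i) +
          ∑ m ∈ Finset.range N, (-1 : ℚ) ^ m * (n + 1).choose (m + 2) * m.choose i := by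
          rw [← Finset.sum_add_distrib]
          refine Finset.sum_congr rfl fun m _ => ?_
          rw [Nat.choose_succ_succ' (n + 1) (m + 1)]
          push_cast
          ring
      _ = _ := by
          rw [sum_choose_succ_mul_choose n i N hN, ih (by omega)]
          split_ifs with hi
          · rw [Nat.succ_sub hi]
            push_cast
            ring
          · rw [Nat.sub_eq_zero_of_le (by omega), Nat.sub_eq_zero_of_le (by omega)]
            simp

theorem alternating_sum_range_choose_succ (j n : ℕ) :
    ∑ i ∈ Finset.range n, (-1 : ℚ) ^ i * (j + 1).choose (i + 1) = 1 - (-1) ^ n * j.choose n := by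
  induction n with
  | zero => simp
  | succ n ih =>
    rw [Finset.sum_range_succ, ih, Nat.choose_succ_succ' j n]
    push_cast
    ring

theorem sum_choose_succ_mul_sub (j n : ℕ) (hj : 0 < j) :
    ∑ i ∈ Finset.range n, (-1 : ℚ) ^ i * (j + 1).choose (i + 1) * (n - i) =
      n + 1 - (-1) ^ n * (j - 1).choose n := by
  obtain ⟨j, rfl⟩ := Nat.exists_eq_add_of_le' hj
  rw [Nat.add_sub_cancel]
  induction n with
  | zero => simp
  | succ n ih =>
    have h := alternating_sum_range_choose_succ (j + 1) (n + 1)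
    calc _ = ∑ i ∈ Finset.range (n + 1), ((-1 : ℚ) ^ i * (j + 1 + 1).choose (i + 1) * (n - i)
            + (-1 : ℚ) ^ i * (j + 1 + 1).choose (i + 1)) := by
          refine Finset.sum_congr rfl fun i _ => ?_
          push_cast
          ring
      _ = _ := by
          rw [Finset.sum_add_distrib, h, Finset.sum_range_succ, ih, Nat.choose_succ_succ' j n]
          push_cast
          ring

/-! ### The recursion for the closed form -/

/-- Up to the factor `1 / (i + 1)`, both sides are the multinomial coefficient of
`p + q + i + (m + 2)`. -/
theorem choose_mul_choose_mul_choose (i p q m : ℕ) :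
    ((p + q + (m + 2 + i)).choose (p + q) : ℚ) * (p + q).choose p * (m + 2 + i).choose i / (i + 1) =
      ((m + 2 + q) + (i + p)).choose (m + 2 + q) * ((i + 1) + p).choose (i + 1) / (i + p + 1) *
        (m + 2 + q).choose (m + 2) := by
  rw [show (m + 2 + i).choose i = (m + 2 + i).choose (m + 2) from Nat.choose_symm_add.symm]
  simp only [Nat.cast_add_choose]
  rw [show p + q + (m + 2 + i) = m + 2 + q + (i + p) by ring,
    show i + 1 + p = (i + p) + 1 by ring, Nat.factorial_succ (i + p), Nat.factorial_succ i]
  have := Nat.factorial_ne_zero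
  have h1 : (((i + p).factorial : ℕ) : ℚ) ≠ 0 := by exact_mod_cast this _
  have h2 : (((p + q).factorial : ℕ) : ℚ) ≠ 0 := by exact_mod_cast this _
  have h3 : (((m + 2 + q).factorial : ℕ) : ℚ) ≠ 0 := by exact_mod_cast this _
  have h4 : (((m + 2 + i).factorial : ℕ) : ℚ) ≠ 0 := by exact_mod_cast this _
  have h5 : (((m + 2).factorial : ℕ) : ℚ) ≠ 0 := by exact_mod_cast this _
  have h6 : ((p.factorial : ℕ) : ℚ) ≠ 0 := by exact_mod_cast this _
  have h7 : ((q.factorial : ℕ) : ℚ) ≠ 0 := by exact_mod_cast this _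
  have h8 : ((i.factorial : ℕ) : ℚ) ≠ 0 := by exact_mod_cast this _
  have h9 : (i : ℚ) + 1 ≠ 0 := by exact_mod_cast i.succ_ne_zero
  have h10 : (i : ℚ) + p + 1 ≠ 0 := by exact_mod_cast (i + p).succ_ne_zero
  push_cast
  field_simp

/-- For fixed `i`, the substitution `k = j + n - 1 - (i + m)` turns the sum over `k` into the sum
over `m` of `sum_choose_add_two_mul_choose`; summands with `j + n - 1 - k < i` vanish. -/
theorem sum_choose_mul_klCoeff {n j i : ℕ} (hi : i ≤ j) (hn : n < j) :
    ∑ k ∈ Finset.range (j + n), (-1 : ℚ) ^ (k + j + i) * (j + n + 1).choose k * k.choose (j - i) *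
      klCoeff (j + n - k) i =
      (-1) ^ (n + 1) * ((j + n + 1).choose (n + 1) / (j + 1)) *
        ((-1) ^ i * (j + 1).choose (i + 1) * (n - i : ℕ)) := by
  obtain ⟨p, rfl⟩ := Nat.exists_eq_add_of_le hi
  rw [← Finset.sum_range_reflect, ← Finset.sum_range_add_sum_Ico _ (show i ≤ i + p + n by omega),
    Finset.sum_eq_zero, zero_add, Finset.sum_Ico_eq_sum_range]
  · rw [mul_right_comm ((-1 : ℚ) ^ i),
      ← sum_choose_add_two_mul_choose n i (i + p + n - i) (by omega),
      Finset.sum_mul, Finset.mul_sum]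
    refine Finset.sum_congr rfl fun m hm => ?_
    simp only [Finset.mem_range] at hm
    have e1 : i + p + n - (i + p + n - 1 - (i + m)) = i + m + 1 := by omega
    have e2 : i + p - i = p := by omega
    rw [e1, e2]
    by_cases hq : m + 1 ≤ n
    · obtain ⟨q, rfl⟩ := Nat.exists_eq_add_of_le hq
      have e3 : i + p + (m + 1 + q) - 1 - (i + m) = p + q := by omega
      have e4 : i + m + 1 - 1 - i = m := by omega
      rw [e3, klCoeff, e4]
      have h := choose_mul_choose_mul_choose i p q m
      rw [show p + q + (m + 2 + i) = i + p + (m + 1 + q) + 1 by ring,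
        show m + 2 + q + (i + p) = i + p + (m + 1 + q) + 1 by ring,
        show m + 2 + i = i + m + 1 + 1 by ring, show i + 1 + p = i + p + 1 by ring,
        show m + 2 + q = m + 1 + q + 1 by ring] at h
      have hs : (-1 : ℚ) ^ (p + q + (i + p) + i) = (-1) ^ (m + 1 + q + 1) * (-1) ^ m := by
        rw [← pow_add, show p + q + (i + p) + i = q + 2 * (p + i) by ring,
          show m + 1 + q + 1 + m = q + 2 * (m + 1) by ring, pow_add, pow_add, pow_mul, pow_mul]
        simp
      rw [hs]
      push_cast at h ⊢
      linear_combination ((-1 : ℚ) ^ (m + 1 + q + 1) * (-1) ^ m * m.choose i) * h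
    · rw [Nat.choose_eq_zero_of_lt (show i + p + n - 1 - (i + m) < p by omega),
        Nat.choose_eq_zero_of_lt (show n + 1 < m + 2 by omega)]
      simp
  · intro s hs
    simp only [Finset.mem_range] at hs
    rw [klCoeff, Nat.choose_eq_zero_of_lt (show _ - 1 - i < i by omega)]
    simp

theorem coeff_X_sub_one_pow_mul_closedForm {e : ℕ} (he : 0 < e) (k j : ℕ) :
    ((X - 1) ^ k * closedForm e).coeff j =
      ∑ i ∈ Finset.range (j + 1), (-1 : ℚ) ^ (k + j + i) * k.choose (j - i) * klCoeff e i := by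
  rw [mul_comm, coeff_mul, Finset.Nat.sum_antidiagonal_eq_sum_range_succ_mk]
  refine Finset.sum_congr rfl fun i hi => ?_
  simp only [Finset.mem_range] at hi
  obtain ⟨p, rfl⟩ := Nat.exists_eq_add_of_le (Nat.lt_succ_iff.1 hi)
  rw [coeff_closedForm he, show (X - 1 : ℚ[X]) = X + C (-1) by simp [sub_eq_add_neg],
    coeff_X_add_C_pow]
  rw [Nat.add_sub_cancel_left]
  by_cases hk : p ≤ k
  · obtain ⟨q, rfl⟩ := Nat.exists_eq_add_of_le hk
    rw [Nat.add_sub_cancel_left, show p + q + (i + p) + i = q + 2 * (p + i) by ring, pow_add,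
      pow_mul]
    simp
    ring
  · rw [Nat.choose_eq_zero_of_lt (by omega)]
    simp

/-- The recursion defining the Kazhdan–Lusztig polynomials, for the closed form: the summands are
indexed by the sizes of the proper flats, and the last term is a coefficient of the characteristic
polynomial. The summand `k = 0` vanishes, since the degree of `closedForm d` is less than
`d / 2`. -/
theorem sum_coeff_closedForm {d n : ℕ} (hn : 2 * n < d) :
    ∑ k ∈ Finset.range d,
      ((d + 1).choose k : ℚ) * ((X - 1) ^ k * closedForm (d - k)).coeff (d - n) =
      klCoeff d n - (-1) ^ n * (d + 1).choose n := by
  obtain ⟨j, rfl⟩ : ∃ j, d = j + n := ⟨d - n, by omega⟩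
  rw [Nat.add_sub_cancel]
  have h1 : ∀ k ∈ Finset.range (j + n),
      ((j + n + 1).choose k : ℚ) * ((X - 1) ^ k * closedForm (j + n - k)).coeff j =
      ∑ i ∈ Finset.range (j + 1), (-1 : ℚ) ^ (k + j + i) * (j + n + 1).choose k *
        k.choose (j - i) * klCoeff (j + n - k) i := by
    intro k hk
    rw [coeff_X_sub_one_pow_mul_closedForm (by simp at hk; omega), Finset.mul_sum]
    exact Finset.sum_congr rfl fun i _ => by ring
  rw [Finset.sum_congr rfl h1, Finset.sum_comm, Finset.sum_congr rfl fun i hi =>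
    sum_choose_mul_klCoeff (Nat.lt_succ_iff.1 (Finset.mem_range.1 hi)) (by omega),
    ← Finset.mul_sum]
  have h2 : ∑ i ∈ Finset.range (j + 1), (-1 : ℚ) ^ i * (j + 1).choose (i + 1) * (n - i : ℕ) =
      ∑ i ∈ Finset.range n, (-1 : ℚ) ^ i * (j + 1).choose (i + 1) * (n - i) := by
    rw [← Finset.sum_subset (Finset.range_subset_range.2 (show n ≤ j + 1 by omega))]
    · refine Finset.sum_congr rfl fun i hi => ?_
      rw [Nat.cast_sub (Finset.mem_range.1 hi).le]
    · intro i _ hi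
      rw [Nat.sub_eq_zero_of_le (by simpa using hi)]
      simp
  rw [h2, sum_choose_succ_mul_sub j n (by omega), klCoeff,
    show j + n - 1 - n = j - 1 by omega]
  have h3 : ((j + n + 1).choose (n + 1) : ℚ) * (n + 1) = (j + n + 1).choose n * (j + 1) := by
    have := Nat.choose_succ_right_eq (j + n + 1) n
    rw [show j + n + 1 - n = j + 1 by omega] at this
    exact_mod_cast this
  have h4 : ((j + n + 1).choose (n + 1) : ℚ) / (j + 1) = (j + n + 1).choose n / (n + 1) := by
    rw [div_eq_div_iff (by positivity) (by positivity), h3]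
  have h5 : ((-1 : ℚ) ^ n) * (-1) ^ n = 1 := by rw [← mul_pow]; simp
  rw [h4, pow_succ]
  field_simp
  linear_combination ((j + n + 1).choose n * (j - 1).choose n : ℚ) * h5

universe u

variable {α : Type u}

/-! ### Sums over flats and Möbius functions -/

theorem isFlat_of_forall_insert_indep {M : Matroid α} {S : Set α} (hS : S ⊆ M.E) (hi : M.Indep S)
    (h : ∀ x ∈ M.E, M.Indep (insert x S)) : M.IsFlat S := by
  rw [Matroid.isFlat_iff_closure_eq]
  refine Set.Subset.antisymm (fun x hx => ?_) (M.subset_closure S hS)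
  rcases hi.mem_closure_iff.1 hx with hd | hd
  · exact absurd (h x (M.closure_subset_ground S hx)) hd.not_indep
  · exact hd

theorem minFlat_val_eq_empty {M : Matroid α} (h : M.IsFlat ∅) : (minFlat M).1 = ∅ := h.closure

open Classical in
/-- The interval below a flat all of whose subsets are flats is a Boolean lattice. -/
theorem mu_minFlat_eq {M : Matroid α} [M.Finite] {F : Flat M} {S : Finset α} (hF : F.1 = S)
    (h : ∀ T ⊆ S, M.IsFlat T) :
    IncidenceAlgebra.mu ℤ (minFlat M) F = (-1) ^ S.card := by
  have h0 : (minFlat M).1 = ∅ := minFlat_val_eq_empty (by simpa using h ∅ (by simp))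
  induction S using Finset.strongInduction generalizing F with
  | H S ih =>
  by_cases hS : S = ∅
  · have : F = minFlat M := by apply Subtype.ext; rw [hF, h0, hS]; simp
    rw [this, IncidenceAlgebra.mu_self, hS]
    simp
  · have hne : minFlat M ≠ F := by
      intro he
      rw [← he, h0] at hF
      exact hS (by simpa using hF.symm)
    rw [IncidenceAlgebra.mu_eq_neg_sum_Ico_of_ne hne]
    have hsum : ∑ T ∈ S.ssubsets, (-1 : ℤ) ^ T.card =
        ∑ x ∈ Finset.Ico (minFlat M) F, IncidenceAlgebra.mu ℤ (minFlat M) x := by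
      refine Finset.sum_bij
        (fun T hT => (⟨T, h T (Finset.mem_ssubsets.1 hT).1⟩ : Flat M)) ?_ ?_ ?_ ?_
      · intro T hT
        rw [Finset.mem_Ico]
        constructor
        · change (minFlat M).1 ⊆ T
          rw [h0]; exact Set.empty_subset _
        · rw [← Subtype.coe_lt_coe, hF]
          exact Finset.coe_ssubset.2 (Finset.mem_ssubsets.1 hT)
      · intro T _ T' _ he
        simpa using he
      · intro x hx
        have hlt : x.1 ⊂ (S : Set α) := by
          rw [← hF]; exact (Finset.mem_Ico.1 hx).2
        have hfin := S.finite_toSet.subset hlt.1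
        refine ⟨hfin.toFinset, ?_, ?_⟩
        · rw [Finset.mem_ssubsets, ← Finset.coe_ssubset, hfin.coe_toFinset]
          exact hlt
        · apply Subtype.ext; simp
      · intro T hT
        have hT' := Finset.mem_ssubsets.1 hT
        exact (ih T hT' rfl fun T' hT'' => h T' (hT''.trans hT'.1)).symm
    rw [← hsum]
    have htot := Finset.sum_powerset_neg_one_pow_card_of_nonempty
      (Finset.nonempty_iff_ne_empty.2 hS)
    rw [← Finset.sum_erase_add _ _ (Finset.mem_powerset_self S)] at htot
    rw [Finset.ssubsets]
    linarith

theorem exists_finset_eq_flat {M : Matroid α} {E : Finset α} (hE : M.E = E) (F : Flat M) :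
    ∃ S ⊆ E, F.1 = S := by
  have hsub : F.1 ⊆ (E : Set α) := hE ▸ F.2.subset_ground
  obtain ⟨S, hS⟩ := (E.finite_toSet.subset hsub).exists_finset_coe
  exact ⟨S, by rwa [← Finset.coe_subset, hS], hS.symm⟩

/-- A sum over flats of a function of the cardinality, provided the function vanishes at the
cardinalities of sets that are not flats. -/
theorem sum_flat_ncard {A : Type*} [AddCommMonoid A] {M : Matroid α} [M.Finite] {E : Finset α}
    (hE : M.E = E) (h : ℕ → A) (hh : ∀ S ⊆ E, ¬ M.IsFlat S → h S.card = 0) :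
    ∑ F : Flat M, h F.1.ncard = ∑ k ∈ Finset.range (E.card + 1), E.card.choose k • h k := by
  classical
  rw [← Finset.sum_powerset_apply_card h,
    ← Finset.sum_filter_of_ne (p := fun S : Finset α => M.IsFlat S)]
  · symm
    refine Finset.sum_bij
      (fun T hT => (⟨T, (Finset.mem_filter.1 hT).2⟩ : Flat M)) ?_ ?_ ?_ ?_
    · intro T _
      simp
    · intro T _ T' _ he
      simpa using he
    · intro x _
      obtain ⟨S, hSE, hS⟩ := exists_finset_eq_flat hE x
      exact ⟨S, Finset.mem_filter.2 ⟨Finset.mem_powerset.2 hSE, hS ▸ x.2⟩, Subtype.ext hS.symm⟩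
    · intro T _
      simp
  · intro S hS hne
    by_contra hf
    exact hne (hh S (Finset.mem_powerset.1 hS) hf)

theorem charPoly_congr {M N : Matroid α} [M.Finite] [N.Finite] (h : M = N) :
    charPoly M = charPoly N := by
  subst h; rfl

theorem rank_of_indep_ground {M : Matroid α} {E : Finset α} (hE : M.E = E) (hi : M.Indep M.E) :
    rank M = E.card := by
  rw [rank, ← M.eRk_ground, hi.eRk_eq_encard, hE, Set.encard_coe_eq_coe_finsetCard]
  simp

theorem charPoly_of_indep_ground {M : Matroid α} [M.Finite] {E : Finset α} (hE : M.E = E)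
    (hi : M.Indep M.E) : charPoly M = (X - 1) ^ E.card := by
  have hflat : ∀ S ⊆ E, M.IsFlat S := by
    intro S hS
    have hS' : (S : Set α) ⊆ M.E := hE ▸ Finset.coe_subset.2 hS
    exact isFlat_of_forall_insert_indep hS' (hi.subset hS')
      fun x hx => hi.subset (Set.insert_subset hx hS')
  have hterm : charPoly M = ∑ F : Flat M, (fun k => (-1) ^ k * X ^ (E.card - k)) F.1.ncard := by
    refine Finset.sum_congr rfl fun F _ => ?_
    obtain ⟨S, hFE, hF⟩ := exists_finset_eq_flat hE F
    rw [mu_minFlat_eq hF fun T hT => hflat T (hT.trans hFE), rank_of_indep_ground hE hi,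
      (hi.subset F.2.subset_ground).eRk_eq_encard, hF, Set.encard_coe_eq_coe_finsetCard,
      Set.ncard_coe_finset]
    simp
  rw [hterm, sum_flat_ncard hE (fun k => (-1) ^ k * X ^ (E.card - k))
      fun S hS hn => absurd (hflat S hS) hn,
    sub_eq_neg_add, add_pow]
  refine Finset.sum_congr rfl fun k _ => ?_
  rw [nsmul_eq_mul, mul_comm]

/-! ### Flats and minors of uniform matroids -/

theorem uniformOn_ground (E : Set α) (d : ℕ) : (uniformOn E d).E = E := rfl

theorem uniformOn_indep_coe_iff {E S : Finset α} {d : ℕ} :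
    (uniformOn (E : Set α) d).Indep S ↔ S ⊆ E ∧ S.card ≤ d := by
  rw [uniformOn_indep_iff, Finset.coe_subset, Set.encard_coe_eq_coe_finsetCard, Nat.cast_le]

theorem rank_uniformOn {E : Finset α} {d : ℕ} (h : d ≤ E.card) :
    rank (uniformOn (E : Set α) d) = d := by
  obtain ⟨S, hS, hcard⟩ := Finset.exists_subset_card_eq h
  obtain ⟨B, hB⟩ := (uniformOn (E : Set α) d).exists_isBase
  have h1 : (uniformOn (E : Set α) d).eRank ≤ d := by
    rw [← hB.encard_eq_eRank]
    exact (uniformOn_indep_iff.1 hB.indep).2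
  have h2 : (d : ℕ∞) ≤ (uniformOn (E : Set α) d).eRank := by
    have := (uniformOn_indep_coe_iff.2 ⟨hS, hcard.le⟩).encard_le_eRank
    rwa [Set.encard_coe_eq_coe_finsetCard, hcard] at this
  rw [rank, le_antisymm h1 h2]
  simp

theorem isFlat_uniformOn_of_card_lt {E S : Finset α} {d : ℕ} (hS : S ⊆ E) (h : S.card < d) :
    (uniformOn (E : Set α) d).IsFlat S := by
  classical
  refine isFlat_of_forall_insert_indep (Finset.coe_subset.2 hS)
    (uniformOn_indep_coe_iff.2 ⟨hS, h.le⟩) fun x hx => ?_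
  rw [← Finset.coe_insert, uniformOn_indep_coe_iff]
  exact ⟨Finset.insert_subset hx hS, (Finset.card_insert_le _ _).trans h⟩

theorem eq_of_isFlat_uniformOn {E S : Finset α} {d : ℕ} (hS : (uniformOn (E : Set α) d).IsFlat S)
    (h : d ≤ S.card) : S = E := by
  classical
  have hSE : S ⊆ E := Finset.coe_subset.1 hS.subset_ground
  obtain ⟨T, hT, hcard⟩ := Finset.exists_subset_card_eq h
  have hTi : (uniformOn (E : Set α) d).Indep T :=
    uniformOn_indep_coe_iff.2 ⟨hT.trans hSE, hcard.le⟩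
  refine hSE.antisymm fun x hx => ?_
  have hmem : x ∈ (uniformOn (E : Set α) d).closure T := by
    rw [hTi.mem_closure_iff]
    by_cases hxT : x ∈ T
    · exact Or.inr hxT
    · refine Or.inl ⟨?_, ?_⟩
      · rw [← Finset.coe_insert, uniformOn_indep_coe_iff, Finset.card_insert_of_notMem hxT]
        omega
      · exact Set.insert_subset hx (Finset.coe_subset.2 (hT.trans hSE))
  have := Matroid.closure_subset_closure _ (Finset.coe_subset.2 hT) hmem
  rwa [hS.closure] at this

theorem uniformOn_contract [DecidableEq α] {E S : Finset α} {d : ℕ} (hS : S ⊆ E)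
    (h : S.card ≤ d) :
    (uniformOn (E : Set α) d).contract S = uniformOn (E \ S : Finset α) (d - S.card) := by
  refine Matroid.ext_indep (by simp [uniformOn_ground]) fun I hI => ?_
  have hsub : I ⊆ (E : Set α) := fun x hx => (hI hx).1
  obtain ⟨T, rfl⟩ := (E.finite_toSet.subset hsub).exists_finset_coe
  rw [(uniformOn_indep_coe_iff.2 ⟨hS, h⟩).contract_indep_iff, ← Finset.coe_union,
    uniformOn_indep_coe_iff, uniformOn_indep_coe_iff, Finset.disjoint_coe, Finset.subset_sdiff]
  constructor
  · rintro ⟨hd, hTE, hc⟩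
    rw [Finset.card_union_of_disjoint hd] at hc
    exact ⟨⟨Finset.union_subset_left hTE, hd⟩, by omega⟩
  · rintro ⟨⟨hTE, hd⟩, hc⟩
    refine ⟨hd, Finset.union_subset hTE hS, ?_⟩
    rw [Finset.card_union_of_disjoint hd]
    omega

/-! ### The closed form of the Kazhdan–Lusztig polynomials -/

/-- Flats of rank `n < d` are the sets of `n` elements, and the intervals below them are Boolean;
the Möbius function at the ground set only enters the constant coefficient. -/
theorem coeff_charPoly_uniformOn {M : Matroid α} [M.Finite] {E : Finset α} {d n : ℕ}
    (hM : M = uniformOn (E : Set α) d) (hE : E.card = d + 1) (hn : n < d) :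
    (charPoly M).coeff (d - n) = (-1) ^ n * (d + 1).choose n := by
  subst hM
  have hterm : (charPoly (uniformOn (E : Set α) d)).coeff (d - n) =
      ∑ F : Flat (uniformOn (E : Set α) d), (fun k => if k = n then (-1 : ℤ) ^ n else 0)
        F.1.ncard := by
    rw [charPoly, finsetSum_coeff]
    refine Finset.sum_congr rfl fun F _ => ?_
    obtain ⟨S, hFE, hF⟩ := exists_finset_eq_flat (uniformOn_ground _ _) F
    have hFl : (uniformOn (E : Set α) d).IsFlat S := hF ▸ F.2
    rw [coeff_C_mul_X_pow, rank_uniformOn (by omega), hF, Set.ncard_coe_finset]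
    by_cases hlt : S.card < d
    · have hi := uniformOn_indep_coe_iff.2 ⟨hFE, hlt.le⟩
      rw [hi.eRk_eq_encard, Set.encard_coe_eq_coe_finsetCard, mu_minFlat_eq hF fun T hT =>
        isFlat_uniformOn_of_card_lt (hT.trans hFE) ((Finset.card_le_card hT).trans_lt hlt)]
      rw [ENat.toNat_natCast]
      by_cases hk : S.card = n <;> dsimp only
      · rw [if_pos hk, if_pos (by omega), hk]
      · rw [if_neg hk, if_neg (by omega)]
    · have heq := eq_of_isFlat_uniformOn hFl (by omega)
      have hr := rank_uniformOn (E := E) (d := d) (by omega)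
      rw [rank, ← Matroid.eRk_ground, uniformOn_ground] at hr
      rw [heq, hr, if_neg (by omega)]
      exact (if_neg (by omega)).symm
  rw [hterm, sum_flat_ncard (uniformOn_ground _ _) (fun k => if k = n then (-1 : ℤ) ^ n else 0), hE]
  · rw [Finset.sum_eq_single_of_mem n (by simp; omega) fun k _ hk => by simp [hk]]
    simp [mul_comm]
  · intro S hS hf
    rw [if_neg]
    rintro rfl
    exact hf (isFlat_uniformOn_of_card_lt hS hn)

/-- By induction on `d`: the proper flats of the uniform matroid of rank `d` on `d + 1` elements
are the subsets with fewer than `d` elements, their localizations are free, and their contractions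
are uniform of the same shape. -/
theorem map_klPoly_uniformOn {d : ℕ} (hd : 0 < d) {M : Matroid α} [M.Finite] {E : Finset α}
    (hM : M = uniformOn (E : Set α) d) (hE : E.card = d + 1) :
    (klPoly M).map (Int.castRingHom ℚ) = closedForm d := by
  classical
  induction d using Nat.strong_induction_on generalizing M E with
  | _ d ih =>
  have hrank : rank M = d := by rw [hM]; exact rank_uniformOn (by omega)
  have hground : M.E = E := by rw [hM]; rfl
  have hempty : M.IsFlat ∅ := by
    rw [hM, ← Finset.coe_empty]; exact isFlat_uniformOn_of_card_lt (by simp) (by simpa)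
  ext n
  rw [klPoly, if_neg (by omega), coeff_closedForm hd, coeff_map, finsetSum_coeff]
  simp only [coeff_C_mul_X_pow, hrank]
  by_cases hn : 2 * n < d
  swap
  · rw [Finset.sum_eq_zero, klCoeff_eq_zero hd (by omega), map_zero]
    intro i hi
    rw [if_neg]
    rintro rfl
    simp at hi
    omega
  rw [Finset.sum_eq_single_of_mem n (by simp; omega) (fun b _ hb => if_neg (Ne.symm hb)),
    if_pos rfl, finsetSum_coeff, map_sum]
  -- The contribution of a flat with `k` elements; no flat has exactly `d` elements.
  set h : ℕ → ℚ := fun k =>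
    if k < d then ((X - 1) ^ k * closedForm (d - k)).coeff (d - n)
    else if k = d + 1 then (-1) ^ n * (d + 1).choose n else 0 with hh
  have hterm : ∀ F : Flat M, F ≠ minFlat M →
      Int.castRingHom ℚ ((charPoly (localization M F) * klPoly (contraction M F)).coeff (d - n)) =
        h F.1.ncard := by
    intro F hF0
    obtain ⟨S, hFE, hF⟩ := exists_finset_eq_flat hground F
    have hFl : (uniformOn (E : Set α) d).IsFlat S := by rw [← hM, ← hF]; exact F.2
    have hnc : F.1.ncard = S.card := by rw [hF, Set.ncard_coe_finset]
    by_cases hlt : S.card < d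
    · have hpos : 0 < S.card := by
        rw [Finset.card_pos, Finset.nonempty_iff_ne_empty]
        intro he
        apply hF0
        apply Subtype.ext
        rw [minFlat_val_eq_empty hempty, hF, he, Finset.coe_empty]
      have hloc : charPoly (localization M F) = (X - 1) ^ S.card := by
        apply charPoly_of_indep_ground hF
        rw [Matroid.restrict_indep_iff, Matroid.restrict_ground_eq]
        have hi : M.Indep S := by rw [hM]; exact uniformOn_indep_coe_iff.2 ⟨hFE, hlt.le⟩
        exact ⟨hF ▸ hi, subset_rfl⟩
      have hcon : contraction M F = uniformOn (E \ S : Finset α)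
          (d - S.card) := by
        rw [← uniformOn_contract hFE hlt.le, ← hM, ← hF]
      have hkl := ih (d - S.card) (by omega) (by omega) hcon
        (by rw [Finset.card_sdiff_of_subset hFE]; omega)
      rw [← coeff_map, Polynomial.map_mul, hkl, hloc, hnc, hh]
      simp [hlt]
    · have heq := eq_of_isFlat_uniformOn hFl (by omega)
      have hFM : F.1 = M.E := by rw [hF, heq, hM]; rfl
      have hcon : klPoly (contraction M F) = 1 := by
        rw [klPoly, if_pos]
        rw [rank, ← Matroid.eRk_ground, Matroid.contract_ground, hFM]
        simp
      have hloc : charPoly (localization M F) = charPoly M := by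
        apply charPoly_congr
        rw [localization, hFM, Matroid.restrict_ground_eq_self]
      rw [hcon, mul_one, hloc, coeff_charPoly_uniformOn hM hE (by omega), hnc, heq, hE, hh]
      simp
  have hmin : h (minFlat M).1.ncard = 0 := by
    rw [minFlat_val_eq_empty hempty, Set.ncard_empty, hh]
    simp only [if_pos hd]
    rw [pow_zero, one_mul, Nat.sub_zero, coeff_closedForm hd, klCoeff_eq_zero hd (by omega)]
  have hsum := Fintype.sum_eq_add_sum_subtype_ne (fun F : Flat M => h F.1.ncard) (minFlat M)
  rw [hmin, zero_add, sum_flat_ncard hground, hE, Finset.sum_range_succ,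
    Finset.sum_range_succ] at hsum
  · rw [Finset.sum_congr rfl fun F _ => hterm F.1 F.2]
    refine hsum.symm.trans ?_
    have hlow : ∑ k ∈ Finset.range d, (d + 1).choose k • h k =
        klCoeff d n - (-1) ^ n * (d + 1).choose n := by
      rw [← sum_coeff_closedForm hn]
      refine Finset.sum_congr rfl fun k hk => ?_
      rw [hh]
      simp only [if_pos (Finset.mem_range.1 hk), nsmul_eq_mul]
    rw [hlow, hh]
    simp
  · intro S hS hf
    rw [hM] at hf
    have h1 : ¬ S.card < d := fun hlt => hf (isFlat_uniformOn_of_card_lt hS hlt)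
    have h2 : S.card ≠ d + 1 := by
      intro hc
      have : S = E := Finset.eq_of_subset_of_card_le hS (by omega)
      exact hf (this ▸ (uniformOn (E : Set α) d).ground_isFlat)
    rw [hh]
    simp [h1, h2]

end KLMatroid

theorem mainTheorem2 (d : ℕ) (hd : 0 < d) (z : ℂ)
    (hz : Polynomial.aeval z (KLMatroid.klPoly (KLMatroid.uniform 1 d)) = 0) :
    ∃ x : ℝ, x < 0 ∧ z = (x : ℂ) := by
  apply KLMatroid.aeval_closedForm_eq_zero hd
  rw [← KLMatroid.map_klPoly_uniformOn hd (M := KLMatroid.uniform 1 d) (E := Finset.univ)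
    (by rw [Finset.coe_univ]; rfl) (by simp [add_comm])]
  rwa [← algebraMap_int_eq, Polynomial.aeval_map_algebraMap]
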